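/- All monoids below other than free monoids $A^*$ are finite. For an element $m$ of a finite monoid, $m^\omega$ denotes the unique idempotent among the powers $m^k$, $k\ge 1$. Let $\mathbf{DA}$ be the class of finite monoids $M$ with $(xyz)^\omega y(xyz)^\omega=(xyz)^\omega$ for all $x,y,z\in M$, and let $\mathbf J$ be the class of finite monoids $M$ with $(xy)^\omega=(yx)^\omega$ and $x^\omega=xx^\omega$ for all $x,y\in M$. For a finite alphabet $A$ and a homomorphism $\psi:A^*\to N$ to a finite monoid, define $\tau_\psi:A^*\to (N\times A\times N)^*$ by $\tau_\psi(a_1\cdots a_k)=\sigma_1\cdots\sigma_k$, where $\sigma_i=(\psi(a_1\cdots a_{i-1}),a_i,\psi(a_{i+1}\cdots a_k))$. For classes $\mathbf V,\mathbf W$ of finite monoids, a finite monoid $M$ belongs to the two-sided semidirect product $\mathbf V\mathbin{**}\mathbf W$ if for every finite alphabet $A$ and every surjective homomorphism $\phi:A^*\to M$ there are homomorphisms $\psi:A^*\to N$ with $N\in\mathbf W$ and $h:(N\times A\times N)^*\to K$ with $K\in\mathbf V$ such that, for all $v,w\in A^*$, $\psi(v)=\psi(w)$ and $h(\tau_\psi(v))=h(\tau_\psi(w))$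 imply $\phi(v)=\phi(w)$. (Whether such $\psi,h$ exist does not depend on the choice of $A$ and $\phi$.) Put $\mathbf V_1=\mathbf J$ and $\mathbf V_{i+1}=\mathbf V_i\mathbin{**}\mathbf J$ for $i\ge 1$. **Theorem.** Let $n>0$. If $M\in\mathbf{DA}$ is generated, as a monoid, by $n$ elements, then $M\in\mathbf V_n$. -/

import Mathlib

universe u

namespace Collapse

/-- A class of monoids (in a fixed universe). -/
abbrev MonoidClass : Type (u + 1) := ∀ (M : Type u) [Monoid M], Prop

section Omega

variable {M : Type u} [Monoid M]

/-- `omegaPow m` is the power `m ^ k` with the least `k > 0` for which `m ^ k` is idempotent. In a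
finite monoid it is the unique idempotent among the powers `m ^ k`, `k > 0`, usually written
`m ^ ω` (see `isIdempotentElem_omegaPow` and `eq_omegaPow`). -/
noncomputable def omegaPow (m : M) : M :=
  m ^ sInf {k : ℕ | 0 < k ∧ IsIdempotentElem (m ^ k)}

theorem exists_isIdempotentElem_pow [Finite M] (m : M) :
    ∃ k : ℕ, 0 < k ∧ IsIdempotentElem (m ^ k) := by
  obtain ⟨i, j, hij, h⟩ := Finite.exists_ne_map_eq_of_infinite (fun k : ℕ => m ^ k)
  wlog hlt : i < j generalizing i j
  · exact this j i hij.symm h.symm (by omega)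
  obtain ⟨p, rfl⟩ := Nat.exists_eq_add_of_lt hlt
  have step : ∀ t, m ^ (i + t) = m ^ (i + t + (p + 1)) := by
    intro t
    have h' : m ^ i = m ^ (i + p + 1) := h
    calc m ^ (i + t) = m ^ i * m ^ t := pow_add _ _ _
      _ = m ^ (i + p + 1) * m ^ t := by rw [h']
      _ = m ^ (i + t + (p + 1)) := by rw [← pow_add]; congr 1; omega
  have steps : ∀ s t, m ^ (i + t) = m ^ (i + t + s * (p + 1)) := by
    intro s
    induction s with
    | zero => intro t; simp
    | succ s ih =>
      intro t
      rw [ih t, Nat.add_assoc i t, step]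
      congr 1
      ring
  refine ⟨(i + 1) * (p + 1), by positivity, ?_⟩
  have key := steps (i + 1) ((i + 1) * (p + 1) - i)
  have hle : i ≤ (i + 1) * (p + 1) := by nlinarith
  rw [Nat.add_sub_cancel' hle] at key
  unfold IsIdempotentElem
  rw [← pow_add]
  exact key.symm

theorem isIdempotentElem_omegaPow [Finite M] (m : M) : IsIdempotentElem (omegaPow m) :=
  (Nat.sInf_mem (s := {k : ℕ | 0 < k ∧ IsIdempotentElem (m ^ k)})
    (exists_isIdempotentElem_pow m)).2

theorem eq_omegaPow [Finite M] (m : M) (k : ℕ) (hk : 0 < k) (h : IsIdempotentElem (m ^ k)) :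
    m ^ k = omegaPow m := by
  have hs := Nat.sInf_mem (s := {k : ℕ | 0 < k ∧ IsIdempotentElem (m ^ k)})
    (exists_isIdempotentElem_pow m)
  unfold omegaPow
  set l := sInf {k : ℕ | 0 < k ∧ IsIdempotentElem (m ^ k)}
  rw [← h.pow_eq hs.1.ne', ← hs.2.pow_eq hk.ne', ← pow_mul, ← pow_mul, mul_comm]

end Omega

/-- The pseudovariety **J**: finite monoids with `(xy)^ω = (yx)^ω` and `x^ω = x x^ω`. -/
def VarJ : MonoidClass.{u} := fun M _ =>
  Finite M ∧ (∀ x y : M, omegaPow (x * y) = omegaPow (y * x)) ∧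
    ∀ x : M, omegaPow x = x * omegaPow x

/-- The pseudovariety **DA**: finite monoids with `(xyz)^ω y (xyz)^ω = (xyz)^ω`. -/
def VarDA : MonoidClass.{u} := fun M _ =>
  Finite M ∧ ∀ x y z : M,
    omegaPow (x * y * z) * y * omegaPow (x * y * z) = omegaPow (x * y * z)

/-- For `ψ : A* → N`, the length-preserving map `τ_ψ : A* → (N × A × N)*` whose value at
`a₁ ⋯ aₖ` has `i`-th letter `(ψ (a₁ ⋯ aᵢ₋₁), aᵢ, ψ (aᵢ₊₁ ⋯ aₖ))`. -/
def transduction {A N : Type u} [Monoid N] (ψ : FreeMonoid A →* N) (w : FreeMonoid A) :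
    FreeMonoid (N × A × N) :=
  FreeMonoid.ofList (List.ofFn fun i : Fin w.toList.length =>
    (ψ (FreeMonoid.ofList (w.toList.take i)), w.toList.get i,
      ψ (FreeMonoid.ofList (w.toList.drop (i + 1)))))

/-- The two-sided semidirect product `V ** W` of classes of finite monoids. A finite monoid `M`
belongs to it if every homomorphism `φ` from a finitely generated free monoid `A*` onto `M` factors
through `(h ∘ τ_ψ, ψ)` for some `ψ : A* → N` with `N` in `W` and some `h : (N × A × N)* → K` with
`K` in `V`. (Whether such `ψ` and `h` exist does not depend on `A` and `φ`.) -/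
def twoSidedProduct (V W : MonoidClass.{u}) : MonoidClass.{u} := fun M _ =>
  Finite M ∧
    ∀ (A : Type u) [Finite A] (φ : FreeMonoid A →* M), Function.Surjective φ →
      ∃ (N : Type u) (_ : Monoid N) (ψ : FreeMonoid A →* N)
        (K : Type u) (_ : Monoid K) (h : FreeMonoid (N × A × N) →* K),
        Finite N ∧ W N ∧ Finite K ∧ V K ∧
          ∀ v w : FreeMonoid A, ψ v = ψ w →
            h (transduction ψ v) = h (transduction ψ w) → φ v = φ w

/-- The hierarchy `V₁ = J`, `Vₙ₊₁ = Vₙ ** J` for `n ≥ 1`. The index `0` is not used; it is given the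
empty class. -/
def VarV : ℕ → MonoidClass.{u}
  | 0 => fun _ _ => False
  | 1 => VarJ
  | n + 2 => twoSidedProduct (VarV (n + 1)) VarJ

end Collapse

namespace Collapse

/-! ### Idempotent powers, and membership in `VarDA` and `VarJ` -/

section OmegaPow

variable {M : Type*} [Monoid M]

/-! Induct on the number of generators. One generator gives a commutative aperiodic monoid, which
lies in `VarJ`. For the step, let `φ` map words over the generators onto `M`, and cut a word
greedily from the left into blocks containing every letter. A completed block either shrinks the
right ideal of the value read so far or, by the `VarDA` identity, shows that this ideal was already
minimal (`isRightMinimal_of_eq_mul`). Hence after `Nat.card M` blocks the prefix value `p` generates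
a minimal right ideal and satisfies `p * y * p = p` for all `y`. Dually, cutting from the right
gives a suffix value `q` with the same property. If the whole value is `p * x = y * q`, it equals `p
* q * p * x = p * q * y * q = p * q`. If one of the two cuts never finishes, its product is the
whole value.

It remains to compute `p` and `q` by a two-sided product. The cutting automaton is monotone and
extensive, so its transition monoid is in `VarJ` and supplies the state at each letter as context.
At a fixed unfinished state some letter never loops, so the loop product lies in a submonoid
generated by the other letters, to which the induction hypothesis applies. The letters leaving a
state are detected by the multiplicative monoid `{0, 1}`. These data determine the product
(`scan_activeWeight_eq`), and closure of the classes under finite products assembles them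
(`factorsThrough_of_forall_closure`). -/

theorem exists_pow_eq_omegaPow [Finite M] (m : M) : ∃ k : ℕ, 0 < k ∧ m ^ k = omegaPow m := by
  obtain ⟨k, hk, h⟩ := exists_isIdempotentElem_pow m
  exact ⟨k, hk, eq_omegaPow m k hk h⟩

theorem map_omegaPow {M' : Type*} [Monoid M'] [Finite M] [Finite M'] (f : M →* M') (m : M) :
    f (omegaPow m) = omegaPow (f m) := by
  obtain ⟨k, hk, h⟩ := exists_pow_eq_omegaPow m
  rw [← h, map_pow]
  refine eq_omegaPow _ k hk ?_
  have := isIdempotentElem_omegaPow m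
  rw [← h] at this
  simpa using this.map f

instance [Finite M] : Finite Mᵐᵒᵖ := Finite.of_equiv M MulOpposite.opEquiv

theorem omegaPow_op [Finite M] (m : M) :
    omegaPow (MulOpposite.op m) = MulOpposite.op (omegaPow m) := by
  obtain ⟨k, hk, h⟩ := exists_pow_eq_omegaPow m
  rw [← h, MulOpposite.op_pow]
  refine (eq_omegaPow _ k hk ?_).symm
  have := isIdempotentElem_omegaPow m
  rw [← h] at this
  rw [← MulOpposite.op_pow]
  exact congrArg MulOpposite.op this

/-- Aperiodicity: take `x = z = 1` in the defining identity; `m` commutes with its own powers. -/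
theorem VarDA.mul_omegaPow (hM : VarDA M) (m : M) : m * omegaPow m = omegaPow m := by
  have := hM.1
  have h := hM.2 1 m 1
  simp only [one_mul, mul_one] at h
  obtain ⟨k, -, hk⟩ := exists_pow_eq_omegaPow m
  have hc : m * omegaPow m = omegaPow m * m := by
    rw [← hk]; exact (Commute.self_pow m k).eq
  calc m * omegaPow m = m * (omegaPow m * omegaPow m) := by rw [isIdempotentElem_omegaPow m]
    _ = omegaPow m * m * omegaPow m := by rw [← mul_assoc, hc]
    _ = _ := h

theorem VarDA.of_injective {M' : Type*} [Monoid M'] (hM : VarDA M) (f : M' →* M)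
    (hf : Function.Injective f) : VarDA M' := by
  have := hM.1
  have hfin : Finite M' := Finite.of_injective f hf
  refine ⟨hfin, fun x y z => hf ?_⟩
  simp only [map_mul, map_omegaPow]
  exact hM.2 _ _ _

theorem VarDA.op (hM : VarDA M) : VarDA Mᵐᵒᵖ := by
  have := hM.1
  refine ⟨inferInstance, fun x y z => ?_⟩
  have h := hM.2 z.unop y.unop x.unop
  have e : x * y * z = MulOpposite.op (z.unop * y.unop * x.unop) := by
    simp [mul_assoc]
  rw [e, omegaPow_op]
  apply MulOpposite.unop_injective
  simpa [mul_assoc] using h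

theorem VarJ.pi {ι : Type*} [Finite ι] {K : ι → Type*} [∀ i, Monoid (K i)]
    (hK : ∀ i, VarJ (K i)) : VarJ (∀ i, K i) := by
  have := fun i => (hK i).1
  have hfin : Finite (∀ i, K i) := inferInstance
  have key : ∀ (x : ∀ i, K i) i, omegaPow x i = omegaPow (x i) := fun x i =>
    map_omegaPow (Pi.evalMonoidHom K i) x
  refine ⟨hfin, fun x y => funext fun i => ?_, fun x => funext fun i => ?_⟩
  · simp only [key, Pi.mul_apply]; exact (hK i).2.1 _ _
  · simp only [key, Pi.mul_apply]; exact (hK i).2.2 _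

/-- A finite monoid with a compatible order whose least element is `1` is in `J`. -/
theorem varJ_of_one_le [Finite M] (r : M → M → Prop) (hrefl : ∀ x, r x x)
    (hanti : ∀ x y, r x y → r y x → x = y) (hone : ∀ x, r 1 x)
    (hmul : ∀ a b c d, r a b → r c d → r (a * c) (b * d)) : VarJ M := by
  have habs : ∀ x : M, omegaPow x = x * omegaPow x := by
    intro x
    obtain ⟨k, hk, h⟩ := exists_pow_eq_omegaPow x
    obtain ⟨k, rfl⟩ := Nat.exists_eq_succ_of_ne_zero hk.ne'
    refine hanti _ _ (by simpa using hmul 1 x _ _ (hone x) (hrefl (omegaPow x))) ?_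
    -- Here `x ≤ x * x ^ k`, and the right side is the idempotent power.
    have h1 := hmul _ _ _ _ (hmul x x _ _ (hrefl x) (hone (x ^ k))) (hrefl (omegaPow x))
    rw [← pow_succ', h, isIdempotentElem_omegaPow x, mul_one] at h1
    exact h1
  have hle : ∀ x y : M, r (omegaPow (y * x)) (omegaPow (x * y)) := by
    intro x y
    obtain ⟨k, hk, h⟩ := exists_pow_eq_omegaPow (y * x)
    obtain ⟨l, hl, h'⟩ := exists_pow_eq_omegaPow (x * y)
    have e1 : (y * x) ^ (k * l) = omegaPow (y * x) := by
      rw [pow_mul, h, (isIdempotentElem_omegaPow _).pow_eq hl.ne']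
    have e2 : (x * y) ^ (k * l) = omegaPow (x * y) := by
      rw [mul_comm, pow_mul, h', (isIdempotentElem_omegaPow _).pow_eq hk.ne']
    -- Inserting `x` and `y` around `(yx)^ω` only increases it, and the result `x (yx)^ω y` is
    -- `(xy)^ω` by aperiodicity.
    have h1 := hmul _ _ _ _ (hmul _ _ _ _ (hone x) (hrefl (omegaPow (y * x)))) (hone y)
    have e3 : x * omegaPow (y * x) * y = omegaPow (x * y) := by
      rw [← e1, mul_assoc, mul_pow_mul, ← mul_assoc, e2, ← habs]
    rwa [one_mul, mul_one, e3] at h1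
  exact ⟨‹_›, fun x y => hanti _ _ (hle _ _) (hle _ _), habs⟩

theorem VarDA.varJ_of_closure_singleton (hM : VarDA M) (g : M)
    (hg : Submonoid.closure {g} = ⊤) : VarJ M := by
  have hc : ∀ x y : M, x * y = y * x := by
    intro x y
    obtain ⟨k, rfl⟩ := Submonoid.mem_closure_singleton.1 (hg ▸ Submonoid.mem_top x)
    obtain ⟨l, rfl⟩ := Submonoid.mem_closure_singleton.1 (hg ▸ Submonoid.mem_top y)
    rw [← pow_add, ← pow_add, add_comm]
  exact ⟨hM.1, fun x y => by rw [hc], fun x => (hM.mul_omegaPow x).symm⟩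

end OmegaPow

/-! ### Minimal right ideals in `VarDA` -/

section Minimal

variable {M : Type*} [Monoid M]

/-- `p` generates a minimal right ideal. -/
def IsRightMinimal (p : M) : Prop := ∀ x, ∃ y, p * x * y = p

theorem IsRightMinimal.mul {p : M} (hp : IsRightMinimal p) (a : M) : IsRightMinimal (p * a) := by
  intro x
  obtain ⟨y, hy⟩ := hp (a * x)
  exact ⟨y * a, by rw [← mul_assoc, mul_assoc p, hy]⟩

/-- Minimality puts `p` in the right ideal of `E = (py)^ω`, so `E * p = p`; aperiodicity then
absorbs the factor `p * y` into `E`. -/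
theorem IsRightMinimal.mul_mul_self (hM : VarDA M) {p : M} (hp : IsRightMinimal p) (y : M) :
    p * y * p = p := by
  have := hM.1
  obtain ⟨k, hk, h⟩ := exists_pow_eq_omegaPow (p * y)
  obtain ⟨k, rfl⟩ := Nat.exists_eq_succ_of_ne_zero hk.ne'
  rw [Nat.succ_eq_add_one, pow_succ', mul_assoc] at h
  obtain ⟨z, hz⟩ := hp (y * (p * y) ^ k)
  rw [h] at hz
  have hE : omegaPow (p * y) * p = p := by
    have e := isIdempotentElem_omegaPow (p * y)
    generalize omegaPow (p * y) = E at hz e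
    rw [← hz, ← mul_assoc, e]
  calc p * y * p = p * y * (omegaPow (p * y) * p) := by rw [hE]
    _ = p := by rw [← mul_assoc, hM.mul_omegaPow, hE]

/-- Multiplication by any word can be undone, one letter at a time. Since `v` contains each letter
`a`, every point on the way back to `p` is fixed by a product with `a` as a middle factor, and the
`VarDA` identity cancels an extra `a`. -/
theorem isRightMinimal_of_eq_mul {B : Type*} (hM : VarDA M) (φ : FreeMonoid B →* M)
    (hφ : Function.Surjective φ) {p t : M} (v : List B) (hv : ∀ b, b ∈ v)
    (h : p * φ (FreeMonoid.ofList v) * t = p) : IsRightMinimal p := by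
  have := hM.1
  intro x
  obtain ⟨x, rfl⟩ := hφ x
  obtain ⟨x, rfl⟩ := FreeMonoid.ofList.surjective x
  induction x using List.reverseRecOn with
  | nil => exact ⟨1, by simp⟩
  | append_singleton x a ih =>
    obtain ⟨z, hz⟩ := ih
    obtain ⟨s₁, s₂, rfl⟩ := List.append_of_mem (hv a)
    set q := p * φ (FreeMonoid.ofList x)
    set X := z * φ (FreeMonoid.ofList s₁)
    set Y := φ (FreeMonoid.of a)
    set Z := φ (FreeMonoid.ofList s₂) * t * φ (FreeMonoid.ofList x)
    have hv' : φ (FreeMonoid.ofList (s₁ ++ a :: s₂)) =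
        φ (FreeMonoid.ofList s₁) * Y * φ (FreeMonoid.ofList s₂) := by
      rw [FreeMonoid.ofList_append, FreeMonoid.ofList_cons]
      simp [Y, mul_assoc]
    have hq : q * (X * Y * Z) = q := by
      calc q * (X * Y * Z) = q * z * (φ (FreeMonoid.ofList s₁) * Y * φ (FreeMonoid.ofList s₂)) * t
            * φ (FreeMonoid.ofList x) := by simp only [X, Z, mul_assoc]
        _ = q := by rw [hz, ← hv', h]
    have hpow : ∀ k : ℕ, q * (X * Y * Z) ^ k = q := by
      intro k
      induction k with
      | zero => simp
      | succ k ih => rw [pow_succ, ← mul_assoc, ih, hq]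
    obtain ⟨k, -, hk⟩ := exists_pow_eq_omegaPow (X * Y * Z)
    have hω : q * omegaPow (X * Y * Z) = q := hk ▸ hpow k
    have hqa : q * Y * omegaPow (X * Y * Z) = q := by
      calc q * Y * omegaPow (X * Y * Z)
          = q * (omegaPow (X * Y * Z) * Y * omegaPow (X * Y * Z)) := by
            rw [← mul_assoc q, ← mul_assoc q, hω]
        _ = q := by rw [hM.2, hω]
    refine ⟨omegaPow (X * Y * Z) * z, ?_⟩
    rw [FreeMonoid.ofList_append, FreeMonoid.ofList_singleton, map_mul, ← mul_assoc p,
      ← mul_assoc, hqa, hz]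

end Minimal

/-! ### Products over letters with their contexts -/

section Context

variable {A N K : Type*} [Monoid N] [Monoid K]

/-- The product of the values of `f` at the letters of a word, each letter taken with its left and
right contexts, inside the outer contexts `x` and `y`. -/
def contextProd (ψ : FreeMonoid A →* N) (f : N → A → N → K) : N → List A → N → K
  | _, [], _ => 1
  | x, a :: v, y =>
    f x a (ψ (FreeMonoid.ofList v) * y) * contextProd ψ f (x * ψ (FreeMonoid.of a)) v y

theorem contextProd_append (ψ : FreeMonoid A →* N) (f : N → A → N → K) (x y : N) (u v : List A) :
    contextProd ψ f x (u ++ v) y = contextProd ψ f x u (ψ (FreeMonoid.ofList v) * y) *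
      contextProd ψ f (x * ψ (FreeMonoid.ofList u)) v y := by
  induction u generalizing x with
  | nil => simp [contextProd]
  | cons a u ih =>
    simp [contextProd, ih, mul_assoc, FreeMonoid.ofList_append, FreeMonoid.ofList_cons]

theorem map_contextProd {K' : Type*} [Monoid K'] (F : K →* K') (ψ : FreeMonoid A →* N)
    (f : N → A → N → K) (x y : N) (v : List A) :
    F (contextProd ψ f x v y) = contextProd ψ (fun x a y => F (f x a y)) x v y := by
  induction v generalizing x with
  | nil => simp [contextProd]
  | cons a v ih => simp [contextProd, ih]

theorem contextProd_map {N' : Type*} [Monoid N'] (F : N →* N') (ψ : FreeMonoid A →* N)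
    (f : N' → A → N' → K) (x y : N) (v : List A) :
    contextProd ψ (fun x a y => f (F x) a (F y)) x v y =
      contextProd (F.comp ψ) f (F x) v (F y) := by
  induction v generalizing x with
  | nil => simp [contextProd]
  | cons a v ih => simp [contextProd, ih]

end Context

theorem lift_transduction {A N : Type u} {K : Type*} [Monoid N] [Monoid K] (ψ : FreeMonoid A →* N)
    (h : FreeMonoid (N × A × N) →* K) (w : FreeMonoid A) :
    h (transduction ψ w) =
      contextProd ψ (fun x a y => h (FreeMonoid.of (x, a, y))) 1 w.toList 1 := by
  have key : ∀ (l : List A) (x y : N),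
      h (FreeMonoid.ofList (List.ofFn fun i : Fin l.length =>
        (x * ψ (FreeMonoid.ofList (l.take i)), l.get i,
          ψ (FreeMonoid.ofList (l.drop (i + 1))) * y))) =
      contextProd ψ (fun x a y => h (FreeMonoid.of (x, a, y))) x l y := by
    intro l
    induction l with
    | nil => intro x y; simp [contextProd]
    | cons a l ih =>
      intro x y
      have := ih (x * ψ (FreeMonoid.of a)) y
      simp only [contextProd, ← this, ← map_mul]
      simp [List.ofFn_succ, FreeMonoid.ofList_cons, mul_assoc]
  have := key w.toList 1 1
  simpa [transduction] using this


/-! ### Products along runs of an automaton -/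

section Scan

variable {P A K : Type*} [Monoid K]

/-- The product of the values of `f` at the steps of the run of an automaton on a word. -/
def scan (step : P → A → P) (f : P → A → K) : P → List A → K
  | _, [] => 1
  | s, a :: v => f s a * scan step f (step s a) v

theorem scan_append (step : P → A → P) (f : P → A → K) (s : P) (u v : List A) :
    scan step f s (u ++ v) = scan step f s u * scan step f (u.foldl step s) v := by
  induction u generalizing s with
  | nil => simp [scan]
  | cons a u ih => simp [scan, ih, mul_assoc]

theorem map_scan {K' : Type*} [Monoid K'] (F : K →* K') (step : P → A → P) (f : P → A → K)
    (s : P) (v : List A) : F (scan step f s v) = scan step (fun s a => F (f s a)) s v := by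
  induction v generalizing s with
  | nil => simp [scan]
  | cons a v ih => simp [scan, ih]

theorem scan_congr {step : P → A → P} {f g : P → A → K} (Q : P → Prop)
    (hQ : ∀ s a, Q s → Q (step s a)) (hfg : ∀ s a, Q s → f s a = g s a) {s : P} (hs : Q s)
    (v : List A) : scan step f s v = scan step g s v := by
  induction v generalizing s with
  | nil => rfl
  | cons a v ih => rw [scan, scan, hfg s a hs, ih (hQ s a hs)]

theorem scan_one (step : P → A → P) (s : P) (v : List A) :
    scan step (fun _ _ => (1 : K)) s v = 1 := by
  induction v generalizing s with
  | nil => rfl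
  | cons a v ih => rw [scan, ih, one_mul]

theorem scan_eq_one {step : P → A → P} {f : P → A → K} (Q : P → Prop)
    (hQ : ∀ s a, Q s → Q (step s a)) (hf : ∀ s a, Q s → f s a = 1) {s : P} (hs : Q s)
    (v : List A) : scan step f s v = 1 :=
  (scan_congr Q hQ hf hs v).trans (scan_one step s v)

theorem scan_loop {step : P → A → P} (f : P → A → K) {s : P} {x : List A}
    (hx : ∀ a ∈ x, step s a = s) : scan step f s x = (x.map (f s)).prod := by
  induction x with
  | nil => rfl
  | cons a x ih =>
    rw [scan, hx a (by simp), ih fun b hb => hx b (by simp [hb])]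
    simp

theorem foldl_loop {step : P → A → P} {s : P} {x : List A}
    (hx : ∀ a ∈ x, step s a = s) : x.foldl step s = s := by
  induction x with
  | nil => rfl
  | cons a x ih => rw [List.foldl_cons, hx a (by simp), ih fun b hb => hx b (by simp [hb])]

theorem scan_loop_append {step : P → A → P} (f : P → A → K) {s : P} {x : List A}
    (hx : ∀ a ∈ x, step s a = s) (a : A) (v : List A) : scan step f s (x ++ a :: v) =
      (x.map (f s)).prod * (f s a * scan step f (step s a) v) := by
  rw [scan_append, foldl_loop hx, scan_loop f hx, scan]

theorem loop_or_exit (step : P → A → P) (s : P) (v : List A) :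
    (∀ a ∈ v, step s a = s) ∨
      ∃ x a v', v = x ++ a :: v' ∧ (∀ b ∈ x, step s b = s) ∧ step s a ≠ s := by
  induction v with
  | nil => simp
  | cons a v ih =>
    by_cases ha : step s a = s
    · rcases ih with h | ⟨x, c, v', rfl, hx, hc⟩
      · left; simpa [ha] using h
      · exact Or.inr ⟨a :: x, c, v', rfl, by simpa [ha] using hx, hc⟩
    · exact Or.inr ⟨[], a, v, rfl, by simp, ha⟩

open Classical in
/-- The weight of a loop at the state `t`. -/
noncomputable def loopWeight (step : P → A → P) (φ : A → K) (t s : P) (a : A) : K :=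
  if s = t ∧ step s a = s then φ a else 1

open Classical in
/-- The weight `0` for leaving the state `t` by the letter `c`. -/
noncomputable def exitWeight (step : P → A → P) (t : P) (c : A) (s : P) (a : A) :
    ULift.{u} (ZMod 2) :=
  if s = t ∧ a = c ∧ step s a ≠ s then 0 else 1

open Classical in
/-- The weight of the letters that are read in a non-terminal state. -/
noncomputable def activeWeight (T : P → Prop) (φ : A → K) (s : P) (a : A) : K :=
  if T s then 1 else φ a

theorem scan_activeWeight_of_terminal {step : P → A → P} {T : P → Prop}
    (hT : ∀ s a, T s → T (step s a)) (φ : A → K) {s : P} (hs : T s) (v : List A) :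
    scan step (activeWeight T φ) s v = 1 :=
  scan_eq_one T hT (fun _ _ h => if_pos h) hs v

/-- An extensive automaton never returns to a state it has left. A run thus splits into loops at
`s`, an exit letter and a run from a larger state, and well-founded induction compares the pieces.
-/
theorem scan_activeWeight_eq [PartialOrder P] [Finite P] {step : P → A → P}
    (hstep : ∀ s a, s ≤ step s a) (T : P → Prop) (hT : ∀ s a, T s → T (step s a)) (φ : A → K)
    (s : P) (v w : List A)
    (hloop : ∀ t, ¬ T t → scan step (loopWeight step φ t) s v = scan step (loopWeight step φ t) s w)
    (hexit : ∀ t c, scan step (exitWeight.{u} step t c) s v = scan step (exitWeight step t c) s w) :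
    scan step (activeWeight T φ) s v = scan step (activeWeight T φ) s w := by
  classical
  induction s using (wellFounded_gt (α := P)).induction generalizing v w with
  | _ s ih =>
  by_cases hs : T s
  · rw [scan_activeWeight_of_terminal hT φ hs, scan_activeWeight_of_terminal hT φ hs]
  have hlt : ∀ a, step s a ≠ s → s < step s a := fun a ha => (hstep s a).lt_of_ne' ha
  have hQ : ∀ (t : P) a, s < t → s < step t a := fun t a h => h.trans_le (hstep t a)
  have lw : ∀ {a}, step s a ≠ s → ∀ t, loopWeight step φ t s a = 1 :=
    fun {a} ha t => if_neg fun h => ha h.2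
  have lw1 : ∀ {x : List A}, (∀ a ∈ x, step s a = s) → ∀ t,
      (x.map (loopWeight step φ t s)).prod = if t = s then (x.map φ).prod else 1 := by
    intro x hx t
    split_ifs with h
    · exact congrArg _ (List.map_congr_left fun a ha => if_pos ⟨h.symm, hx a ha⟩)
    · exact List.prod_eq_one (by
        simp only [List.mem_map]
        rintro _ ⟨a, -, rfl⟩
        exact if_neg fun h' => h h'.1.symm)
  have lw2 : ∀ {a}, step s a ≠ s → ∀ v, scan step (loopWeight step φ s) (step s a) v = 1 :=
    fun {a} ha v => scan_eq_one (s < ·) hQ (fun t a h => if_neg fun h' => h.ne' h'.1) (hlt a ha) v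
  have ew1 : ∀ {x : List A}, (∀ a ∈ x, step s a = s) → ∀ t c,
      (x.map (exitWeight.{u} step t c s)).prod = 1 := by
    intro x hx t c
    exact List.prod_eq_one (by
      simp only [List.mem_map]
      rintro _ ⟨a, ha, rfl⟩
      exact if_neg fun h' => h'.2.2 (hx a ha))
  have ew2 : ∀ {a}, step s a ≠ s → ∀ c v,
      scan step (exitWeight.{u} step s c) (step s a) v = 1 :=
    fun {a} ha c v =>
      scan_eq_one (s < ·) hQ (fun t a h => if_neg fun h' => h.ne' h'.1) (hlt a ha) v
  have aw : ∀ x : List A, (x.map (activeWeight T φ s)).prod = (x.map φ).prod := fun x =>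
    congrArg _ (List.map_congr_left fun a _ => if_neg hs)
  have h01 : (0 : ULift.{u} (ZMod 2)) ≠ 1 := by
    intro h; exact absurd (congrArg ULift.down h) (by decide)
  have e0 : ∀ {a}, step s a ≠ s → exitWeight.{u} step s a s a = 0 :=
    fun {a} ha => if_pos ⟨rfl, rfl, ha⟩
  -- The exit weight at `s` is `0` exactly when the run leaves by the given letter, so both words
  -- stay at `s` or both leave by the same letter.
  rcases loop_or_exit step s v with hv | ⟨x, a, v, rfl, hx, ha⟩ <;>
    rcases loop_or_exit step s w with hw | ⟨y, c, w, rfl, hy, hc⟩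
  · have := hloop s hs
    rw [scan_loop _ hv, scan_loop _ hw, lw1 hv, lw1 hw, if_pos rfl, if_pos rfl] at this
    rw [scan_loop _ hv, scan_loop _ hw, aw, aw, this]
  · have := hexit s c
    rw [scan_loop _ hv, scan_loop_append _ hy, ew1 hv, ew1 hy, e0 hc, zero_mul, mul_zero] at this
    exact absurd this.symm h01
  · have := hexit s a
    rw [scan_loop _ hw, scan_loop_append _ hx, ew1 hw, ew1 hx, e0 ha, zero_mul, mul_zero] at this
    exact absurd this h01
  · have hac : c = a := by
      by_contra hne
      have := hexit s a
      rw [scan_loop_append _ hx, scan_loop_append _ hy, ew1 hx, ew1 hy, e0 ha, ew2 hc,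
        exitWeight, if_neg fun h => hne h.2.1, zero_mul, mul_zero, one_mul, one_mul] at this
      exact h01 this
    subst hac
    have hxy := hloop s hs
    rw [scan_loop_append _ hx, scan_loop_append _ hy, lw1 hx, lw1 hy, if_pos rfl, if_pos rfl,
      lw ha, lw2 ha, lw2 ha, one_mul, mul_one, mul_one] at hxy
    rw [scan_loop_append _ hx, scan_loop_append _ hy, aw, aw, hxy]
    congr 2
    refine ih _ (hlt c ha) v w (fun t ht => ?_) fun t d => ?_
    · by_cases hts : t = s
      · rw [hts, lw2 ha, lw2 ha]
      · have := hloop t ht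
        rwa [scan_loop_append _ hx, scan_loop_append _ hy, lw1 hx, lw1 hy, if_neg hts, if_neg hts, lw ha,
          one_mul, one_mul, one_mul, one_mul] at this
    · by_cases hts : t = s
      · rw [hts, ew2 ha, ew2 ha]
      · have := hexit t d
        rwa [scan_loop_append _ hx, scan_loop_append _ hy, ew1 hx, ew1 hy, exitWeight,
          if_neg fun h => hts h.1.symm, one_mul, one_mul, one_mul, one_mul] at this

theorem scan_activeWeight_mul {step : P → A → P} (T : P → Prop)
    (hT : ∀ s a, T s → T (step s a)) (φ : A → K) (s : P) (v : List A) :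
    ∃ y, (v.map φ).prod = scan step (activeWeight T φ) s v * y := by
  induction v generalizing s with
  | nil => exact ⟨1, by simp [scan]⟩
  | cons a v ih =>
    by_cases hs : T s
    · exact ⟨_, by rw [scan_activeWeight_of_terminal hT φ hs, one_mul]⟩
    · obtain ⟨y, hy⟩ := ih (step s a)
      exact ⟨y, by rw [scan, activeWeight, if_neg hs, List.map_cons, List.prod_cons, hy, mul_assoc]⟩

theorem scan_activeWeight_eq_prod {step : P → A → P} (T : P → Prop)
    (hT : ∀ s a, T s → T (step s a)) (φ : A → K) (s : P) (v : List A)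
    (h : ¬ T (v.foldl step s)) :
    scan step (activeWeight T φ) s v = (v.map φ).prod := by
  induction v generalizing s with
  | nil => rfl
  | cons a v ih =>
    have hs : ¬ T s := by
      have key : ∀ (v : List A) s, T s → T (v.foldl step s) := by
        intro v
        induction v with
        | nil => exact fun s h => h
        | cons a v ih => exact fun s h => ih _ (hT s a h)
      exact fun hs => h (key _ _ hs)
    rw [scan, activeWeight, if_neg hs, List.map_cons, List.prod_cons, ih _ h]

end Scan

/-! ### The greedy block automaton -/

section Blocks

variable {B : Type*} [Fintype B] [DecidableEq B] (L : ℕ)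

/-- States of the automaton that cuts a word greedily into blocks containing all letters: the number
of completed blocks, up to `L`, and the set of letters of the current block. -/
abbrev BlockState (B : Type*) (L : ℕ) := Fin (L + 1) ×ₗ Finset B

/-- The transitions of the block automaton. -/
def blockStep (s : BlockState B L) (a : B) : BlockState B L :=
  if h : (ofLex s).1.val < L then
    if insert a (ofLex s).2 = Finset.univ then toLex (⟨(ofLex s).1.val + 1, by omega⟩, ∅)
    else toLex ((ofLex s).1, insert a (ofLex s).2)
  else s

/-- The state in which all blocks are completed. -/
def IsTerminal {L : ℕ} (s : BlockState B L) : Prop := ¬ (ofLex s).1.val < L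

variable {L}

theorem le_blockStep (s : BlockState B L) (a : B) : s ≤ blockStep L s a := by
  unfold blockStep
  split_ifs with h h'
  · refine Prod.Lex.le_iff.2 (Or.inl ?_)
    simp [Fin.lt_def]
  · refine Prod.Lex.le_iff.2 (Or.inr ⟨rfl, ?_⟩)
    exact Finset.subset_insert _ _
  · exact le_rfl

/-- One step from a state with fewer blocks reaches at most the next count with the empty set, which
is the least state having that count. -/
theorem blockStep_mono (a : B) : Monotone fun s : BlockState B L => blockStep L s a := by
  intro s t hst
  by_cases ht : (ofLex t).1.val < L
  · rw [Prod.Lex.le_iff] at hst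
    rcases hst with hst | ⟨h1, h2⟩
    · have hs : (ofLex s).1.val < L := lt_trans hst ht
      have h1 : blockStep L s a ≤ toLex ((⟨(ofLex s).1.val + 1, by omega⟩ : Fin (L + 1)), ∅) := by
        unfold blockStep
        rw [dif_pos hs]
        split_ifs
        · exact le_rfl
        · refine Prod.Lex.le_iff.2 (Or.inl ?_)
          simp [Fin.lt_def]
      refine h1.trans (le_trans ?_ (le_blockStep t a))
      refine Prod.Lex.le_iff.2 ?_
      have h2 : (ofLex s).1.val + 1 ≤ (ofLex t).1.val := hst
      rcases h2.lt_or_eq with h3 | h3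
      · exact Or.inl h3
      · exact Or.inr ⟨Fin.ext h3, Finset.empty_subset _⟩
    · have hs : (ofLex s).1.val < L := by rw [h1]; exact ht
      have h3 : insert a (ofLex s).2 ⊆ insert a (ofLex t).2 := Finset.insert_subset_insert _ h2
      simp only [blockStep, dif_pos hs, dif_pos ht]
      split_ifs with h4 h5 h5
      · simp [h1]
      · exact absurd (Finset.univ_subset_iff.1 (h4 ▸ h3)) h5
      · refine Prod.Lex.le_iff.2 (Or.inl ?_)
        simp [Fin.lt_def, h1]
      · exact Prod.Lex.le_iff.2 (Or.inr ⟨h1, h3⟩)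
  · have e : blockStep L t a = t := dif_neg ht
    by_cases hs : (ofLex s).1.val < L
    · simp only [e]
      unfold blockStep
      rw [dif_pos hs, Prod.Lex.le_iff]
      split_ifs
      · rcases (show (ofLex s).1.val + 1 ≤ (ofLex t).1.val by omega).lt_or_eq with h3 | h3
        · exact Or.inl h3
        · exact Or.inr ⟨Fin.ext h3, Finset.empty_subset _⟩
      · exact Or.inl (show (ofLex s).1.val < (ofLex t).1.val by omega)
    · have e' : blockStep L s a = s := dif_neg hs
      simpa only [e, e'] using hst

theorem IsTerminal.blockStep (s : BlockState B L) (a : B) (h : IsTerminal s) :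
    IsTerminal (blockStep L s a) := by
  have e : Collapse.blockStep L s a = s := dif_neg h
  rwa [e]

/-- A looping letter already belongs to the current set, so any letter missing from that set will
do. If the set is full, no letter loops and `b` is arbitrary. -/
theorem exists_forall_ne_of_blockStep_eq {s : BlockState B L} (hs : ¬ IsTerminal s) [Nonempty B] :
    ∃ b, ∀ a, blockStep L s a = s → a ≠ b := by
  have hs' : (ofLex s).1.val < L := not_not.1 hs
  have key : ∀ a, blockStep L s a = s → a ∈ (ofLex s).2 ∧ (ofLex s).2 ≠ Finset.univ := by
    intro a ha
    rw [blockStep, dif_pos hs'] at ha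
    split_ifs at ha with h
    · have := congrArg (fun t => (ofLex t).1.val) ha
      simp at this
    · have h1 : insert a (ofLex s).2 = (ofLex s).2 := congrArg (fun t => (ofLex t).2) ha
      exact ⟨h1 ▸ Finset.mem_insert_self _ _, h1 ▸ h⟩
  by_cases h : (ofLex s).2 = Finset.univ
  · exact ⟨Classical.arbitrary B, fun a ha => absurd h (key a ha).2⟩
  · obtain ⟨b, hb⟩ : ∃ b, b ∉ (ofLex s).2 := by
      by_contra! h'
      exact h (Finset.eq_univ_of_forall h')
    exact ⟨b, fun a ha hab => hb (hab ▸ (key a ha).1)⟩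

/-- In `hinv`, `m'` is the value at the last block boundary and `x` the current block. Each boundary
costs an element of the right ideal of `m'`; as that ideal is never empty, `L` boundaries force
minimality. -/
theorem isRightMinimal_mul_scan {M : Type*} [Monoid M] (hM : VarDA M) (φ : FreeMonoid B →* M)
    (hφ : Function.Surjective φ) (hL : Nat.card M ≤ L) (v : List B) (s : BlockState B L) (m : M)
    (hinv : IsRightMinimal m ∨ ∃ (m' : M) (x : List B), m = m' * φ (FreeMonoid.ofList x) ∧
      (∀ a ∈ (ofLex s).2, a ∈ x) ∧ (Set.range (m' * ·)).ncard + (ofLex s).1.val ≤ Nat.card M)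
    (hv : IsTerminal (v.foldl (blockStep L) s)) :
    IsRightMinimal
      (m * scan (blockStep L) (activeWeight IsTerminal (φ ∘ FreeMonoid.of)) s v) := by
  have := hM.1
  have hterm : ∀ (s : BlockState B L) (m : M), (IsRightMinimal m ∨ ∃ (m' : M) (x : List B),
      m = m' * φ (FreeMonoid.ofList x) ∧ (∀ a ∈ (ofLex s).2, a ∈ x) ∧
      (Set.range (m' * ·)).ncard + (ofLex s).1.val ≤ Nat.card M) →
      IsTerminal s → IsRightMinimal m := by
    intro s m hinv hs
    rcases hinv with h | ⟨m', -, -, -, h⟩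
    · exact h
    · have h1 : 0 < (Set.range (m' * ·)).ncard :=
        (Set.ncard_pos (Set.toFinite _)).2 (Set.range_nonempty _)
      have : ¬ (ofLex s).1.val < L := hs
      omega
  induction v generalizing s m with
  | nil => simpa [scan] using hterm s m hinv hv
  | cons a v ih =>
    by_cases hs : IsTerminal s
    · rw [scan_activeWeight_of_terminal IsTerminal.blockStep _ hs, mul_one]
      exact hterm s m hinv hs
    have hstep : IsRightMinimal (m * φ (FreeMonoid.of a)) ∨ ∃ (m' : M) (x : List B),
        m * φ (FreeMonoid.of a) = m' * φ (FreeMonoid.ofList x) ∧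
        (∀ b ∈ (ofLex (blockStep L s a)).2, b ∈ x) ∧
        (Set.range (m' * ·)).ncard + (ofLex (blockStep L s a)).1.val ≤ Nat.card M := by
      rcases hinv with h | ⟨m', x, rfl, hx, hc⟩
      · exact Or.inl (h.mul _)
      have hxa : m' * φ (FreeMonoid.ofList x) * φ (FreeMonoid.of a) =
          m' * φ (FreeMonoid.ofList (x ++ [a])) := by
        rw [FreeMonoid.ofList_append, FreeMonoid.ofList_singleton, map_mul, mul_assoc]
      have hins : ∀ b ∈ insert a (ofLex s).2, b ∈ x ++ [a] := by
        intro b hb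
        rcases Finset.mem_insert.1 hb with rfl | hb
        · simp
        · simp [hx b hb]
      rw [hxa, blockStep, dif_pos (not_not.1 hs)]
      split_ifs with hfull
      · set y := φ (FreeMonoid.ofList (x ++ [a]))
        have hsub : Set.range (m' * y * ·) ⊆ Set.range (m' * ·) := by
          rintro _ ⟨z, rfl⟩
          exact ⟨y * z, by simp [mul_assoc]⟩
        -- If the block can be undone, `m'` was already minimal; otherwise `m'` itself drops out of
        -- the right ideal.
        by_cases heq : m' ∈ Set.range (m' * y * ·)
        · obtain ⟨t, ht⟩ := heq
          exact Or.inl ((isRightMinimal_of_eq_mul hM φ hφ (x ++ [a])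
            (fun b => hins b (hfull ▸ Finset.mem_univ b)) ht).mul _)
        · have hlt : (Set.range (m' * y * ·)).ncard < (Set.range (m' * ·)).ncard :=
            Set.ncard_lt_ncard (Set.ssubset_iff_exists.2 ⟨hsub, m', ⟨1, by simp⟩, heq⟩)
              (Set.toFinite _)
          refine Or.inr ⟨m' * y, [], by simp, by simp, ?_⟩
          simp only [ofLex_toLex]
          omega
      · exact Or.inr ⟨m', x ++ [a], rfl, hins, hc⟩
    rw [scan, activeWeight, if_neg hs, ← mul_assoc]
    exact ih _ _ hstep hv
end Blocks


/-! ### Factorizations and finite products -/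

section Factorization

/-- The homomorphism `φ` factors through `(h ∘ τ_ψ, ψ)` with `ψ` into a member of `W` and `h` into a
member of `V`. -/
def FactorsThrough (V W : MonoidClass.{u}) {A M : Type u} [Monoid M] (φ : FreeMonoid A →* M) :
    Prop :=
  ∃ (N : Type u) (_ : Monoid N) (ψ : FreeMonoid A →* N)
    (K : Type u) (_ : Monoid K) (h : FreeMonoid (N × A × N) →* K),
    Finite N ∧ W N ∧ Finite K ∧ V K ∧
      ∀ v w : FreeMonoid A, ψ v = ψ w →
        h (transduction ψ v) = h (transduction ψ w) → φ v = φ w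

theorem factorsThrough_iff {V W : MonoidClass.{u}} {A M : Type u} [Monoid M]
    {φ : FreeMonoid A →* M} : FactorsThrough V W φ ↔
      ∃ (N : Type u) (_ : Monoid N) (ψ : FreeMonoid A →* N) (K : Type u) (_ : Monoid K)
        (f : N → A → N → K), Finite N ∧ W N ∧ Finite K ∧ V K ∧
          ∀ v w : List A, ψ (FreeMonoid.ofList v) = ψ (FreeMonoid.ofList w) →
            contextProd ψ f 1 v 1 = contextProd ψ f 1 w 1 →
              φ (FreeMonoid.ofList v) = φ (FreeMonoid.ofList w) := by
  constructor
  · rintro ⟨N, _, ψ, K, _, h, hN, hW, hK, hV, H⟩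
    refine ⟨N, _, ψ, K, _, fun x a y => h (FreeMonoid.of (x, a, y)), hN, hW, hK, hV, ?_⟩
    intro v w hvw hc
    refine H _ _ hvw ?_
    rw [lift_transduction, lift_transduction]
    exact hc
  · rintro ⟨N, _, ψ, K, _, f, hN, hW, hK, hV, H⟩
    refine ⟨N, _, ψ, K, _, FreeMonoid.lift fun p => f p.1 p.2.1 p.2.2, hN, hW, hK, hV, ?_⟩
    intro v w hvw hc
    rw [lift_transduction, lift_transduction] at hc
    exact H v.toList w.toList hvw (by simpa only [FreeMonoid.lift_eval_of] using hc)

/-- Substitute for each letter a word with the same value, and collect the contributions of that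
word into one letter weight. Hence a single presentation of `M` suffices. -/
theorem FactorsThrough.of_surjective {V W : MonoidClass.{u}} {A B M : Type u} [Monoid M]
    {φ : FreeMonoid B →* M} (h : FactorsThrough V W φ) (hφ : Function.Surjective φ)
    (χ : FreeMonoid A →* M) : FactorsThrough V W χ := by
  rw [factorsThrough_iff] at h ⊢
  obtain ⟨N, _, ψ, K, _, f, hN, hW, hK, hV, H⟩ := h
  choose g hg using hφ
  let θ : FreeMonoid A →* FreeMonoid B := FreeMonoid.lift fun a => g (χ (FreeMonoid.of a))
  have hθ : ∀ v, φ (θ v) = χ v := by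
    intro v
    have : φ.comp θ = χ := FreeMonoid.hom_eq fun a => by simp [θ, hg]
    exact DFunLike.congr_fun this v
  refine ⟨N, _, ψ.comp θ, K, _, fun x a y => contextProd ψ f x (θ (FreeMonoid.of a)).toList y,
    hN, hW, hK, hV, ?_⟩
  have key : ∀ (v : List A) (x y : N), contextProd (ψ.comp θ)
      (fun x a y => contextProd ψ f x (θ (FreeMonoid.of a)).toList y) x v y =
      contextProd ψ f x (θ (FreeMonoid.ofList v)).toList y := by
    intro v
    induction v with
    | nil => intro x y; simp [contextProd]
    | cons a v ih =>
      intro x y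
      rw [FreeMonoid.ofList_cons, map_mul, FreeMonoid.toList_mul, contextProd_append, contextProd,
        ih]
      simp
  intro v w hvw hc
  rw [key, key] at hc
  rw [← hθ, ← hθ]
  exact H _ _ hvw hc

theorem FactorsThrough.pi {V W : MonoidClass.{u}} {ι : Type u} [Finite ι]
    (hV : ∀ (K : ι → Type u) [∀ i, Monoid (K i)], (∀ i, V (K i)) → V (∀ i, K i))
    (hW : ∀ (K : ι → Type u) [∀ i, Monoid (K i)], (∀ i, W (K i)) → W (∀ i, K i))
    {A : Type u} {M : ι → Type u} [∀ i, Monoid (M i)] (φ : FreeMonoid A →* ∀ i, M i)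
    (h : ∀ i, FactorsThrough V W ((Pi.evalMonoidHom M i).comp φ)) : FactorsThrough V W φ := by
  simp only [factorsThrough_iff] at h ⊢
  choose N iN ψ K iK f hN hWN hK hVK H using h
  let Ψ : FreeMonoid A →* ∀ i, N i := MonoidHom.pi ψ
  refine ⟨∀ i, N i, inferInstance, Ψ, ∀ i, K i, inferInstance,
    fun x a y i => f i (x i) a (y i), inferInstance, hW N hWN, inferInstance, hV K hVK, ?_⟩
  intro v w hvw hc
  funext i
  refine H i v w (congrFun hvw i) ?_
  have key : ∀ v : List A, contextProd Ψ (fun x a y i => f i (x i) a (y i)) 1 v 1 i =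
      contextProd (ψ i) (f i) 1 v 1 := by
    intro v
    refine (map_contextProd (Pi.evalMonoidHom K i) _ _ _ _ _).trans ?_
    exact contextProd_map (Pi.evalMonoidHom N i) Ψ (f i) 1 1 v
  rw [← key, ← key, hc]

theorem VarV.finite {n : ℕ} {M : Type u} [Monoid M] (h : VarV n M) : Finite M := by
  match n with
  | 0 => exact h.elim
  | 1 => exact h.1
  | n + 2 => exact h.1

theorem VarV.pi (n : ℕ) {ι : Type u} [Finite ι] (K : ι → Type u) [∀ i, Monoid (K i)]
    (hK : ∀ i, VarV (n + 1) (K i)) : VarV (n + 1) (∀ i, K i) := by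
  induction n generalizing K with
  | zero => exact VarJ.pi hK
  | succ n ih =>
    have := fun i => (hK i).finite
    refine ⟨inferInstance, fun A _ φ hφ => ?_⟩
    refine FactorsThrough.pi (fun K _ hK => ih K hK) (fun K _ hK => VarJ.pi hK) φ fun i => ?_
    exact (hK i).2 A _ ((Function.surjective_eval i).comp hφ)

/-- The relation `R` between words is implied by the equality of the values of a homomorphism
into a member of `V` at the words `τ_ψ v`, `τ_ψ w`. -/
def IsDetermined (V : MonoidClass.{u}) {A N : Type u} [Monoid N] (ψ : FreeMonoid A →* N)
    (R : List A → List A → Prop) : Prop :=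
  ∃ (K : Type u) (_ : Monoid K) (f : N → A → N → K), Finite K ∧ V K ∧
    ∀ v w, contextProd ψ f 1 v 1 = contextProd ψ f 1 w 1 → R v w

variable {V : MonoidClass.{u}} {A N : Type u} [Monoid N] {ψ : FreeMonoid A →* N}

theorem IsDetermined.forall
    (hV : ∀ {ι : Type u} [Finite ι] (K : ι → Type u) [∀ i, Monoid (K i)],
      (∀ i, V (K i)) → V (∀ i, K i)) {ι : Type u} [Finite ι]
    {R : ι → List A → List A → Prop} (h : ∀ i, IsDetermined V ψ (R i)) :
    IsDetermined V ψ fun v w => ∀ i, R i v w := by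
  choose K iK f hK hVK H using h
  refine ⟨∀ i, K i, inferInstance, fun x a y i => f i x a y, inferInstance, hV K hVK, ?_⟩
  intro v w hc i
  refine H i v w ?_
  have key : ∀ v : List A, contextProd ψ (fun x a y i => f i x a y) 1 v 1 i =
      contextProd ψ (f i) 1 v 1 := fun v => map_contextProd (Pi.evalMonoidHom K i) _ _ _ _ _
  rw [← key, ← key, hc]

theorem IsDetermined.and
    (hV : ∀ {ι : Type u} [Finite ι] (K : ι → Type u) [∀ i, Monoid (K i)],
      (∀ i, V (K i)) → V (∀ i, K i)) {R S : List A → List A → Prop}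
    (hR : IsDetermined V ψ R) (hS : IsDetermined V ψ S) :
    IsDetermined V ψ fun v w => R v w ∧ S v w := by
  obtain ⟨K, _, f, hK, hVK, H⟩ := IsDetermined.forall hV (ι := ULift Bool)
    (R := fun i => if i.down then R else S) (by rintro ⟨_ | _⟩ <;> assumption)
  exact ⟨K, _, f, hK, hVK, fun v w h => ⟨H v w h ⟨true⟩, H v w h ⟨false⟩⟩⟩

end Factorization

/-! ### Automata run from both ends -/

section TwoSidedAutomaton

variable {P A : Type u}

/-- The monotone extensive self-maps of an ordered set. -/
def extensiveMaps (P : Type u) [Preorder P] : Submonoid (Function.End P) where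
  carrier := {f | Monotone f ∧ ∀ s, s ≤ f s}
  one_mem' := ⟨monotone_id, fun _ => le_rfl⟩
  mul_mem' hf hg := ⟨hf.1.comp hg.1, fun s => (hg.2 s).trans (hf.2 _)⟩

/-- Pairs of a left and a right action by monotone extensive maps. -/
abbrev BiActions (P : Type u) [Preorder P] : Type u := (extensiveMaps P)ᵐᵒᵖ × extensiveMaps P

instance [PartialOrder P] [Finite P] : Finite (BiActions P) := by
  have : Finite (Function.End P) := inferInstanceAs (Finite (P → P))
  infer_instance

theorem varJ_biActions [PartialOrder P] [Finite P] : VarJ (BiActions P) := by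
  -- The order is pointwise: extensivity puts `1` at the bottom, and monotonicity makes composition
  -- compatible.
  refine varJ_of_one_le (fun x y => (∀ s, x.1.unop.1 s ≤ y.1.unop.1 s) ∧
    ∀ s, x.2.1 s ≤ y.2.1 s) ?_ ?_ ?_ ?_
  · exact fun x => ⟨fun _ => le_rfl, fun _ => le_rfl⟩
  · intro x y h h'
    refine Prod.ext (MulOpposite.unop_injective (Subtype.ext (funext fun s => ?_)))
      (Subtype.ext (funext fun s => ?_))
    · exact le_antisymm (h.1 s) (h'.1 s)
    · exact le_antisymm (h.2 s) (h'.2 s)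
  · exact fun x => ⟨x.1.unop.2.2, x.2.2.2⟩
  · intro a b c d h h'
    exact ⟨fun s => (c.1.unop.2.1 (h.1 s)).trans (h'.1 _),
      fun s => (a.2.2.1 (h'.2 s)).trans (h.2 _)⟩

variable [PartialOrder P] (step : P → A → P) (hle : ∀ s a, s ≤ step s a)
  (hmono : ∀ a, Monotone fun s => step s a)

/-- The homomorphism given by running an automaton from the left and from the right. -/
def biRun : FreeMonoid A →* BiActions P :=
  FreeMonoid.lift fun a =>
    (MulOpposite.op ⟨fun s => step s a, hmono a, fun s => hle s a⟩,
      ⟨fun s => step s a, hmono a, fun s => hle s a⟩)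

theorem biRun_left (v : List A) (s : P) :
    (biRun step hle hmono (FreeMonoid.ofList v)).1.unop.1 s = v.foldl step s := by
  induction v generalizing s with
  | nil => rfl
  | cons a v ih =>
    rw [List.foldl_cons, ← ih, FreeMonoid.ofList_cons, map_mul]
    rfl

theorem biRun_right (v : List A) (s : P) :
    (biRun step hle hmono (FreeMonoid.ofList v)).2.1 s = v.reverse.foldl step s := by
  induction v generalizing s with
  | nil => rfl
  | cons a v ih =>
    rw [List.reverse_cons, List.foldl_append, ← ih, FreeMonoid.ofList_cons, map_mul]
    rfl

variable {K : Type*} [Monoid K] (g : P → A → K)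

theorem contextProd_biRun_left (s : P) (v : List A) :
    contextProd (biRun step hle hmono) (fun x a _ => g (x.1.unop.1 s) a) 1 v 1 =
      scan step g s v := by
  have key : ∀ (x y : BiActions P),
      contextProd (biRun step hle hmono) (fun x a _ => g (x.1.unop.1 s) a) x v y =
      scan step g (x.1.unop.1 s) v := by
    induction v with
    | nil => exact fun x y => rfl
    | cons a v ih =>
      intro x y
      rw [contextProd, ih, scan]
      rfl
  exact key 1 1

theorem contextProd_biRun_right (s : P) (v : List A) :
    MulOpposite.op (contextProd (biRun step hle hmono) (fun _ a y => g (y.2.1 s) a) 1 v 1) =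
      scan step (fun s a => MulOpposite.op (g s a)) s v.reverse := by
  have key : ∀ (x y : BiActions P), MulOpposite.op
      (contextProd (biRun step hle hmono) (fun _ a y => g (y.2.1 s) a) x v y) =
      scan step (fun s a => MulOpposite.op (g s a)) (y.2.1 s) v.reverse := by
    induction v with
    | nil => exact fun x y => rfl
    | cons a v ih =>
      intro x y
      rw [contextProd, MulOpposite.op_mul, ih, List.reverse_cons, scan_append]
      congr 1
      rw [← biRun_right step hle hmono]
      simp [scan]
      rfl
  exact key 1 1

end TwoSidedAutomaton

/-! ### The inductive step and the theorem -/

section Main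

variable {V : MonoidClass.{u}} {B M : Type u} [Monoid M]

theorem factorsThrough_of_forall_closure (hfin : ∀ (K : Type u) [Monoid K], V K → Finite K)
    (hV : ∀ {ι : Type u} [Finite ι] (K : ι → Type u) [∀ i, Monoid (K i)],
      (∀ i, V (K i)) → V (∀ i, K i))
    (hU : V (ULift.{u} (ZMod 2))) [Finite B] [Nonempty B] (hM : VarDA M) (φ : FreeMonoid B →* M)
    (hφ : Function.Surjective φ)
    (hsub : ∀ b, V (Submonoid.closure (φ ∘ FreeMonoid.of '' {b}ᶜ))) :
    FactorsThrough V VarJ φ := by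
  classical
  have := Fintype.ofFinite B
  have := hM.1
  obtain ⟨L, hL⟩ : ∃ L, L = Nat.card M := ⟨_, rfl⟩
  let step := blockStep (B := B) L
  let s₀ : BlockState B L := toLex (0, ∅)
  let ψ : FreeMonoid B →* BiActions (BlockState B L) := biRun step le_blockStep blockStep_mono
  have : Finite (BlockState B L) := inferInstanceAs (Finite (Fin (L + 1) × Finset B))
  let φ₁ : B → M := φ ∘ FreeMonoid.of
  let φ₂ : B → Mᵐᵒᵖ := MulOpposite.op ∘ φ₁
  have hφ₁ : ∀ v : List B, (v.map φ₁).prod = φ (FreeMonoid.ofList v) := by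
    intro v
    induction v with
    | nil => simp
    | cons a v ih => rw [List.map_cons, List.prod_cons, ih, FreeMonoid.ofList_cons, map_mul]; rfl
  let Φ : FreeMonoid B →* Mᵐᵒᵖ := FreeMonoid.lift φ₂
  have hΦ : ∀ v : List B, (v.reverse.map φ₂).prod = MulOpposite.op (φ (FreeMonoid.ofList v)) := by
    intro v
    rw [← hφ₁, MulOpposite.op_list_prod, List.map_reverse, List.map_map]
  have hΦsurj : Function.Surjective Φ := by
    intro m
    obtain ⟨v, hv⟩ := hφ m.unop
    refine ⟨FreeMonoid.ofList v.toList.reverse, ?_⟩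
    rw [FreeMonoid.lift_apply, FreeMonoid.toList_ofList, hΦ, FreeMonoid.ofList_toList, hv,
      MulOpposite.op_unop]
  -- The weights of the loops at a non-terminal state are determined, from both sides.
  have hmem : ∀ t : BlockState B L, ¬ IsTerminal t → ∃ b, ∀ s a,
      loopWeight step φ₁ t s a ∈ Submonoid.closure (φ ∘ FreeMonoid.of '' {b}ᶜ) := by
    intro t ht
    obtain ⟨b, hb⟩ := exists_forall_ne_of_blockStep_eq ht
    refine ⟨b, fun s a => ?_⟩
    unfold loopWeight
    split_ifs with h
    · exact Submonoid.subset_closure ⟨a, hb a (h.1 ▸ h.2), rfl⟩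
    · exact one_mem _
  have loopL : ∀ t : BlockState B L, IsDetermined V ψ fun v w => ¬ IsTerminal t →
      scan step (loopWeight step φ₁ t) s₀ v = scan step (loopWeight step φ₁ t) s₀ w := by
    intro t
    by_cases ht : IsTerminal t
    -- Nothing is required at terminal states, where all letters may loop.
    · exact ⟨_, _, fun _ _ _ => 1, hfin _ hU, hU, fun _ _ _ h => absurd ht h⟩
    obtain ⟨b, hb⟩ := hmem t ht
    refine ⟨_, _, fun x a _ => ⟨loopWeight step φ₁ t (x.1.unop.1 s₀) a, hb _ _⟩,
      hfin _ (hsub b), hsub b, fun v w h _ => ?_⟩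
    have h' := congrArg (Submonoid.subtype _) h
    rw [map_contextProd, map_contextProd] at h'
    rw [← contextProd_biRun_left step le_blockStep blockStep_mono,
      ← contextProd_biRun_left step le_blockStep blockStep_mono]
    exact h'
  have loopR : ∀ t : BlockState B L, IsDetermined V ψ fun v w => ¬ IsTerminal t →
      scan step (loopWeight step φ₂ t) s₀ v.reverse =
        scan step (loopWeight step φ₂ t) s₀ w.reverse := by
    intro t
    by_cases ht : IsTerminal t
    · exact ⟨_, _, fun _ _ _ => 1, hfin _ hU, hU, fun _ _ _ h => absurd ht h⟩
    obtain ⟨b, hb⟩ := hmem t ht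
    refine ⟨_, _, fun _ a y => ⟨loopWeight step φ₁ t (y.2.1 s₀) a, hb _ _⟩,
      hfin _ (hsub b), hsub b, fun v w h _ => ?_⟩
    have h' := congrArg (Submonoid.subtype _) h
    rw [map_contextProd, map_contextProd] at h'
    have e : loopWeight step φ₂ t = fun s a => MulOpposite.op (loopWeight step φ₁ t s a) := by
      funext s a
      unfold loopWeight
      split_ifs <;> rfl
    rw [e, ← contextProd_biRun_right step le_blockStep blockStep_mono,
      ← contextProd_biRun_right step le_blockStep blockStep_mono]
    exact congrArg _ h'
  have exitL : ∀ (t : BlockState B L) (c : B), IsDetermined V ψ fun v w =>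
      scan step (exitWeight.{u} step t c) s₀ v = scan step (exitWeight.{u} step t c) s₀ w := by
    intro t c
    refine ⟨_, _, fun x a _ => exitWeight.{u} step t c (x.1.unop.1 s₀) a, hfin _ hU, hU,
      fun v w h => ?_⟩
    beta_reduce
    rw [← contextProd_biRun_left step le_blockStep blockStep_mono,
      ← contextProd_biRun_left step le_blockStep blockStep_mono]
    exact h
  have exitR : ∀ (t : BlockState B L) (c : B), IsDetermined V ψ fun v w =>
      scan step (exitWeight.{u} step t c) s₀ v.reverse =
        scan step (exitWeight.{u} step t c) s₀ w.reverse := by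
    intro t c
    refine ⟨_, _, fun _ a y => exitWeight.{u} step t c (y.2.1 s₀) a, hfin _ hU, hU,
      fun v w h => ?_⟩
    have key : ∀ v : List B, scan step (exitWeight.{u} step t c) s₀ v.reverse =
        contextProd (biRun step le_blockStep blockStep_mono)
          (fun _ a y => exitWeight.{u} step t c (y.2.1 s₀) a) 1 v 1 := by
      intro v
      apply MulOpposite.op_injective
      rw [contextProd_biRun_right step le_blockStep blockStep_mono]
      -- The exit weights commute, so reversing the order of multiplication changes nothing.
      exact map_scan ((MonoidHom.id (ULift.{u} (ZMod 2))).toOpposite mul_comm) _ _ _ _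
    beta_reduce
    rw [key, key]
    exact h
  obtain ⟨K, _, f, hK, hVK, H⟩ :=
    ((IsDetermined.forall hV loopL).and hV
      (IsDetermined.forall hV fun t => IsDetermined.forall hV (exitL t))).and hV
    ((IsDetermined.forall hV loopR).and hV
      (IsDetermined.forall hV fun t => IsDetermined.forall hV (exitR t)))
  refine factorsThrough_iff.2 ⟨_, _, ψ, K, _, f, inferInstance, varJ_biActions, hK, hVK, ?_⟩
  intro v w hvw hc
  obtain ⟨⟨h₁, h₂⟩, h₃, h₄⟩ := H v w hc
  have hleft : v.foldl step s₀ = w.foldl step s₀ := by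
    rw [← biRun_left step le_blockStep blockStep_mono, ← biRun_left step le_blockStep blockStep_mono]
    exact congrArg (fun x => x.1.unop.1 s₀) hvw
  have hright : v.reverse.foldl step s₀ = w.reverse.foldl step s₀ := by
    rw [← biRun_right step le_blockStep blockStep_mono,
      ← biRun_right step le_blockStep blockStep_mono]
    exact congrArg (fun x => x.2.1 s₀) hvw
  have eL := scan_activeWeight_eq le_blockStep IsTerminal IsTerminal.blockStep φ₁ s₀ v w h₁ h₂
  have eR := scan_activeWeight_eq le_blockStep IsTerminal IsTerminal.blockStep φ₂ s₀ _ _ h₃ h₄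
  -- If either cut is unfinished, its active product is the whole value; otherwise the value is the
  -- product of both.
  by_cases hTL : IsTerminal (v.foldl step s₀)
  swap
  · rw [← hφ₁, ← hφ₁,
      ← scan_activeWeight_eq_prod IsTerminal IsTerminal.blockStep φ₁ s₀ v hTL,
      ← scan_activeWeight_eq_prod IsTerminal IsTerminal.blockStep φ₁ s₀ w (hleft ▸ hTL)]
    exact eL
  by_cases hTR : IsTerminal (v.reverse.foldl step s₀)
  swap
  · apply MulOpposite.op_injective
    rw [← hΦ, ← hΦ,
      ← scan_activeWeight_eq_prod IsTerminal IsTerminal.blockStep φ₂ s₀ _ hTR,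
      ← scan_activeWeight_eq_prod IsTerminal IsTerminal.blockStep φ₂ s₀ _ (hright ▸ hTR)]
    exact eR
  have key : ∀ v : List B, IsTerminal (v.foldl step s₀) → IsTerminal (v.reverse.foldl step s₀) →
      φ (FreeMonoid.ofList v) = scan step (activeWeight IsTerminal φ₁) s₀ v *
        (scan step (activeWeight IsTerminal φ₂) s₀ v.reverse).unop := by
    intro v hvL hvR
    have hp := (isRightMinimal_mul_scan hM φ hφ hL.ge v s₀ 1 (Or.inr ⟨1, [], by simp, by simp [s₀],
      by simp [s₀, Set.ncard_univ]⟩) hvL).mul_mul_self hM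
    have hq := (isRightMinimal_mul_scan hM.op Φ hΦsurj
      ((Nat.card_congr MulOpposite.opEquiv.symm).trans hL.symm).le v.reverse s₀ 1
      (Or.inr ⟨1, [], by simp, by simp [s₀],
      by simp [s₀, Set.ncard_univ]⟩) hvR).mul_mul_self hM.op
    obtain ⟨x, hx⟩ := scan_activeWeight_mul IsTerminal IsTerminal.blockStep φ₁ s₀ v
    obtain ⟨y, hy⟩ := scan_activeWeight_mul IsTerminal IsTerminal.blockStep φ₂ s₀ v.reverse
    have eΦ : Φ ∘ FreeMonoid.of = φ₂ := funext fun a => FreeMonoid.lift_eval_of _ _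
    rw [hφ₁] at hx
    rw [hΦ] at hy
    rw [eΦ] at hq
    simp only [one_mul] at hp hq
    change ∀ z, scan step (activeWeight IsTerminal φ₁) s₀ v * z *
      scan step (activeWeight IsTerminal φ₁) s₀ v = _ at hp
    change ∀ z, scan step (activeWeight IsTerminal φ₂) s₀ v.reverse * z *
      scan step (activeWeight IsTerminal φ₂) s₀ v.reverse = _ at hq
    change _ = scan step _ s₀ v * x at hx
    change _ = scan step _ s₀ v.reverse * y at hy
    generalize scan step (activeWeight IsTerminal φ₁) s₀ v = p at hp hx ⊢
    generalize scan step (activeWeight IsTerminal φ₂) s₀ v.reverse = q at hq hy ⊢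
    have hy' := congrArg MulOpposite.unop hy
    rw [MulOpposite.unop_op, MulOpposite.unop_mul] at hy'
    have hq' : ∀ z, q.unop * z * q.unop = q.unop := by
      intro z
      have := congrArg MulOpposite.unop (hq (MulOpposite.op z))
      simpa [mul_assoc] using this
    calc φ (FreeMonoid.ofList v) = p * q.unop * p * x := by rw [hp, hx]
      _ = p * (q.unop * y.unop * q.unop) := by rw [mul_assoc, ← hx, hy']; simp only [mul_assoc]
      _ = p * q.unop := by rw [hq']
  rw [key v hTL hTR, key w (hleft ▸ hTL) (hright ▸ hTR)]
  exact congrArg₂ (fun p q => p * MulOpposite.unop q) eL eR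

theorem varDA_zmod_two : VarDA (ULift.{u} (ZMod 2)) := by
  have hi : ∀ x : ULift.{u} (ZMod 2), x * x = x := by
    rintro ⟨x⟩
    exact congrArg ULift.up ((by decide : ∀ x : ZMod 2, x * x = x) x)
  have hω : ∀ x : ULift.{u} (ZMod 2), omegaPow x = x := fun x => by
    rw [← eq_omegaPow x 1 one_pos (hi _), pow_one]
  refine ⟨inferInstance, fun x y z => ?_⟩
  rw [hω]
  calc x * y * z * y * (x * y * z) = (x * x) * (y * y * y) * (z * z) := by ring
    _ = x * y * z := by simp only [hi]

theorem varV_of_varDA (n : ℕ) (M : Type u) [Monoid M] (hM : VarDA M) (g : Fin (n + 1) → M)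
    (hg : Submonoid.closure (Set.range g) = ⊤) : VarV (n + 1) M := by
  induction n generalizing M with
  | zero =>
    refine hM.varJ_of_closure_singleton (g 0) ?_
    rw [← hg]
    congr 1
    ext x
    simp [Fin.exists_fin_one, eq_comm]
  | succ n ih =>
    let B : Type u := ULift (Fin (n + 2))
    let φ : FreeMonoid B →* M := FreeMonoid.lift fun b => g b.down
    have hφ : Function.Surjective φ := by
      rw [← MonoidHom.mrange_eq_top, FreeMonoid.mrange_lift, ← hg]
      congr 1
      exact (Equiv.ulift.surjective).range_comp g
    refine ⟨hM.1, fun A _ χ _ => FactorsThrough.of_surjective (φ := φ) ?_ hφ χ⟩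
    refine factorsThrough_of_forall_closure (fun K _ => VarV.finite) (VarV.pi n) ?_ hM φ hφ ?_
    -- The multiplicative monoid `{0, 1}` is generated by `0` alone, so repeating that generator
    -- allows the induction hypothesis.
    · refine ih _ varDA_zmod_two (fun _ => 0) (eq_top_iff.2 ?_)
      rintro ⟨x⟩ -
      have : x = 0 ∨ x = 1 := by revert x; decide
      rcases this with rfl | rfl
      · exact Submonoid.subset_closure ⟨0, rfl⟩
      · exact one_mem _
    · rintro ⟨b⟩
      set S := φ ∘ FreeMonoid.of '' {(⟨b⟩ : B)}ᶜ
      have hmem : ∀ i, g (b.succAbove i) ∈ S := fun i =>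
        ⟨⟨b.succAbove i⟩, fun h => Fin.succAbove_ne b i (congrArg ULift.down h), by simp [φ]⟩
      refine ih _ (hM.of_injective (Submonoid.closure S).subtype Subtype.val_injective)
        (fun i => ⟨g (b.succAbove i), Submonoid.subset_closure (hmem i)⟩) ?_
      rw [eq_top_iff, ← Submonoid.closure_closure_coe_preimage]
      refine Submonoid.closure_mono ?_
      rintro ⟨_, _⟩ ⟨⟨a⟩, ha, rfl⟩
      obtain ⟨i, hi⟩ := Fin.exists_succAbove_eq (x := a) (y := b) fun h => ha (congrArg ULift.up h)
      exact ⟨i, Subtype.ext (by simp [φ, hi])⟩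

end Main

end Collapse

theorem mainTheorem5 (n : ℕ) (hn : 0 < n) (M : Type u) [Monoid M] (hM : Collapse.VarDA M)
    (hgen : ∃ g : Fin n → M, Submonoid.closure (Set.range g) = ⊤) :
    Collapse.VarV n M := by
  obtain ⟨n, rfl⟩ := Nat.exists_eq_succ_of_ne_zero hn.ne'
  obtain ⟨g, hg⟩ := hgen
  exact Collapse.varV_of_varDA n M hM g hg
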